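/- Let $q\in(0,1)$ be a real number and let $k,l\geq 1$ be coprime integers. All algebras are unital, associative and over $\mathbb{C}$. Let $\mathcal{O}(SU_q(2))$ be the universal $*$-algebra generated by $\alpha,\beta$ subject to the relations $$\alpha\beta=q\beta\alpha,\quad \alpha\beta^*=q\beta^*\alpha,\quad \beta\beta^*=\beta^*\beta,\quad \alpha\alpha^*=\alpha^*\alpha+(q^{-2}-1)\beta\beta^*,\quad \alpha\alpha^*+\beta\beta^*=1.$$ Let $\mathbb{C}[u,u^*]$ be the Hopf $*$-algebra of Laurent polynomials in a unitary, grouplike generator $u$ (so $u^*=u^{-1}$), let $$\varrho_{k,l}:\mathcal{O}(SU_q(2))\to\mathcal{O}(SU_q(2))\otimes\mathbb{C}[u,u^*],\qquad \alpha\mapsto\alpha\otimes u^k,\quad \beta\mapsto\beta\otimes u^{-l},$$ be the coaction extended as a $*$-algebra homomorphism, and let $$\mathcal{O}(\mathbb{WP}_q(k,l))=\{x\in\mathcal{O}(SU_q(2)) \mid \varrho_{k,l}(x)=x\otimes 1\}$$ be the subalgebra of coinvariants. Put $a=\beta\beta^*$ and $b=\alpha^l\beta^k$. (i) $\mathcal{O}(\mathbb{WP}_q(k,l))$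 is the $*$-subalgebra of $\mathcal{O}(SU_q(2))$ generated by $a$ and $b$. (ii) The elements $a$ and $b$ satisfy the relations $$a^*=a,\quad ab=q^{-2l}ba,\quad bb^*=q^{2kl}a^k\prod_{m=0}^{l-1}(1-q^{2m}a),\quad b^*b=a^k\prod_{m=1}^{l}(1-q^{-2m}a).$$ (iii) The universal $*$-algebra with generators $\tilde a,\tilde b$ and the relations in (ii) (with $\tilde a,\tilde b$ in place of $a,b$) is isomorphic to $\mathcal{O}(\mathbb{WP}_q(k,l))$ as a $*$-algebra, via an isomorphism that sends $\tilde a$ to $a$ and $\tilde b$ to $b$. -/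

import Mathlib

open scoped TensorProduct LaurentPolynomial

/-! ## The free complex `*`-algebra on a set of generators -/

/-- The opposite algebra `Aᵐᵒᵖ` with the complex scalars acting through complex conjugation. A
complex algebra map `B → ConjOp A` is a conjugate-linear antimultiplicative map `B → A`. -/
def ConjOp (A : Type*) : Type _ := Aᵐᵒᵖ

namespace ConjOp

variable {A : Type*} [Ring A] [Algebra ℂ A]

instance : Ring (ConjOp A) := inferInstanceAs (Ring Aᵐᵒᵖ)

instance : Algebra ℂ (ConjOp A) :=
  RingHom.toAlgebra' ((algebraMap ℂ Aᵐᵒᵖ).comp (starRingEnd ℂ))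
    (fun c x => Algebra.commutes (A := Aᵐᵒᵖ) (starRingEnd ℂ c) x)

end ConjOp

/-- The free unital complex `*`-algebra on `X`: the free complex algebra on the generators `x`
(`Sum.inl x`) and their formal adjoints `x*` (`Sum.inr x`). -/
def FreeStarAlgebra (X : Type*) : Type _ := FreeAlgebra ℂ (X ⊕ X)

namespace FreeStarAlgebra

noncomputable section

variable {X : Type*}

instance : Ring (FreeStarAlgebra X) := inferInstanceAs (Ring (FreeAlgebra ℂ (X ⊕ X)))

instance : Algebra ℂ (FreeStarAlgebra X) := inferInstanceAs (Algebra ℂ (FreeAlgebra ℂ (X ⊕ X)))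

/-- The letters `x` and `x*`. -/
def letter (s : X ⊕ X) : FreeStarAlgebra X := FreeAlgebra.ι ℂ s

/-- The conjugate-linear antimultiplicative map that exchanges `x` and `x*`. -/
def starHom : FreeStarAlgebra X →ₐ[ℂ] ConjOp (FreeStarAlgebra X) :=
  FreeAlgebra.lift ℂ (fun s : X ⊕ X => (MulOpposite.op (letter s.swap) : (FreeStarAlgebra X)ᵐᵒᵖ))

instance : Star (FreeStarAlgebra X) where
  star x := MulOpposite.unop (starHom x : (FreeStarAlgebra X)ᵐᵒᵖ)

theorem star_letter (s : X ⊕ X) : star (letter s) = letter s.swap := by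
  exact congrArg (MulOpposite.unop (α := FreeStarAlgebra X))
    (FreeAlgebra.lift_ι_apply (R := ℂ) (A := ConjOp (FreeStarAlgebra X)) _ s)

theorem star_mul' (x y : FreeStarAlgebra X) : star (x * y) = star y * star x := by
  change MulOpposite.unop (starHom (x * y) : (FreeStarAlgebra X)ᵐᵒᵖ) = _
  rw [map_mul]; rfl

theorem star_add' (x y : FreeStarAlgebra X) : star (x + y) = star x + star y := by
  change MulOpposite.unop (starHom (x + y) : (FreeStarAlgebra X)ᵐᵒᵖ) = _
  rw [map_add]; rfl

theorem star_algebraMap' (c : ℂ) :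
    star (algebraMap ℂ (FreeStarAlgebra X) c) = algebraMap ℂ _ (star c) := by
  change MulOpposite.unop (starHom (algebraMap ℂ _ c) : (FreeStarAlgebra X)ᵐᵒᵖ) = _
  rw [AlgHom.commutes]; rfl

/-- Induction over the free `*`-algebra. -/
theorem induction {C : FreeStarAlgebra X → Prop} (hc : ∀ c, C (algebraMap ℂ _ c))
    (hl : ∀ s, C (letter s)) (hm : ∀ x y, C x → C y → C (x * y))
    (ha : ∀ x y, C x → C y → C (x + y)) (x : FreeStarAlgebra X) : C x :=
  FreeAlgebra.induction ℂ (X ⊕ X) (motive := C) hc hl hm ha x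

instance : StarRing (FreeStarAlgebra X) where
  star_involutive x := by
    induction x using induction with
    | hc c => rw [star_algebraMap', star_algebraMap', star_star]
    | hl s => rw [star_letter, star_letter, Sum.swap_swap]
    | hm x y hx hy => rw [star_mul', star_mul', hx, hy]
    | ha x y hx hy => rw [star_add', star_add', hx, hy]
  star_mul := star_mul'
  star_add := star_add'

instance : StarModule ℂ (FreeStarAlgebra X) where
  star_smul c x := by
    rw [Algebra.smul_def, star_mul', star_algebraMap', Algebra.smul_def, Algebra.commutes]

/-- The generator `x` of the free `*`-algebra. -/
def gen (x : X) : FreeStarAlgebra X := letter (Sum.inl x)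

theorem star_gen (x : X) : star (gen x) = letter (Sum.inr x) := star_letter _

variable {A : Type*} [Ring A] [Algebra ℂ A] [StarRing A]

/-- The algebra map underlying `lift`. -/
def liftAlg (f : X → A) : FreeStarAlgebra X →ₐ[ℂ] A :=
  FreeAlgebra.lift ℂ (Sum.elim f (fun x => star (f x)))

theorem liftAlg_letter (f : X → A) (s : X ⊕ X) :
    liftAlg f (letter s) = Sum.elim f (fun x => star (f x)) s :=
  FreeAlgebra.lift_ι_apply _ _

variable [StarModule ℂ A]

theorem liftAlg_star (f : X → A) (x : FreeStarAlgebra X) :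
    liftAlg f (star x) = star (liftAlg f x) := by
  induction x using induction with
  | hc c => rw [star_algebraMap', AlgHom.commutes, AlgHom.commutes, algebraMap_star_comm]
  | hl s => rw [star_letter, liftAlg_letter, liftAlg_letter]; cases s <;> simp
  | hm x y hx hy => rw [star_mul', map_mul, map_mul, star_mul, hx, hy]
  | ha x y hx hy => rw [star_add', map_add, map_add, star_add, hx, hy]

/-- The `*`-homomorphism from the free `*`-algebra given by the images of the generators. -/
def lift (f : X → A) : FreeStarAlgebra X →⋆ₐ[ℂ] A :=
  { liftAlg f with map_star' := liftAlg_star f }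

@[simp] theorem lift_gen (f : X → A) (x : X) : lift f (gen x) = f x := liftAlg_letter f _

end

end FreeStarAlgebra

/-! ## `*`-algebras given by generators and relations -/

/-- The relations `r` together with their adjoints. -/
inductive StarClosure {X : Type*} (r : FreeStarAlgebra X → FreeStarAlgebra X → Prop) :
    FreeStarAlgebra X → FreeStarAlgebra X → Prop
  | of {x y} : r x y → StarClosure r x y
  | star {x y} : r x y → StarClosure r (star x) (star y)

theorem StarClosure.star_mem {X : Type*} {r : FreeStarAlgebra X → FreeStarAlgebra X → Prop}
    (x y : FreeStarAlgebra X) (h : StarClosure r x y) :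
    StarClosure r (Star.star x) (Star.star y) := by
  cases h with
  | of h => exact .star h
  | star h => rw [star_star, star_star]; exact .of h

/-- The universal unital complex `*`-algebra on the generators `X` and the relations `r`: the
quotient of the free `*`-algebra by the two-sided `*`-ideal generated by the relations. -/
def PresentedStarAlgebra {X : Type*} (r : FreeStarAlgebra X → FreeStarAlgebra X → Prop) : Type _ :=
  RingQuot (StarClosure r)

namespace PresentedStarAlgebra

noncomputable section

variable {X : Type*} {r : FreeStarAlgebra X → FreeStarAlgebra X → Prop}

instance : Ring (PresentedStarAlgebra r) := inferInstanceAs (Ring (RingQuot (StarClosure r)))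

instance : Algebra ℂ (PresentedStarAlgebra r) :=
  inferInstanceAs (Algebra ℂ (RingQuot (StarClosure r)))

instance : StarRing (PresentedStarAlgebra r) :=
  RingQuot.starRing (StarClosure r) StarClosure.star_mem

variable (r) in
/-- The algebra map underlying `mk`. -/
def mkAlg : FreeStarAlgebra X →ₐ[ℂ] PresentedStarAlgebra r := RingQuot.mkAlgHom ℂ (StarClosure r)

theorem mkAlg_surjective : Function.Surjective (mkAlg r) := RingQuot.mkAlgHom_surjective ℂ _

theorem mkAlg_star (x : FreeStarAlgebra X) : mkAlg r (star x) = star (mkAlg r x) := by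
  unfold mkAlg
  simp only [RingQuot.mkAlgHom, RingQuot.mkRingHom]
  rfl

instance : StarModule ℂ (PresentedStarAlgebra r) where
  star_smul c x := by
    obtain ⟨x, rfl⟩ := mkAlg_surjective x
    rw [← map_smul, ← mkAlg_star, ← mkAlg_star, star_smul, map_smul]

variable (r) in
/-- The quotient map from the free `*`-algebra. -/
def mk : FreeStarAlgebra X →⋆ₐ[ℂ] PresentedStarAlgebra r :=
  { mkAlg r with map_star' := mkAlg_star }

theorem mk_surjective : Function.Surjective (mk r) := mkAlg_surjective

/-- The relations hold in the presented `*`-algebra. -/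
theorem mk_rel {x y : FreeStarAlgebra X} (h : r x y) : mk r x = mk r y :=
  RingQuot.mkAlgHom_rel ℂ (StarClosure.of h)

variable (r) in
/-- The generators of the presented `*`-algebra. -/
def gen (x : X) : PresentedStarAlgebra r := mk r (FreeStarAlgebra.gen x)

variable {A : Type*} [Ring A] [Algebra ℂ A] [StarRing A] [StarModule ℂ A]

/-- The algebra map underlying `lift`. -/
def liftAlg (f : X → A)
    (h : ∀ x y, r x y → FreeStarAlgebra.lift f x = FreeStarAlgebra.lift f y) :
    PresentedStarAlgebra r →ₐ[ℂ] A :=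
  RingQuot.liftAlgHom ℂ ⟨(FreeStarAlgebra.lift f).toAlgHom, by
    intro x y hxy
    cases hxy with
    | of hxy => exact h _ _ hxy
    | star hxy =>
      exact (map_star (FreeStarAlgebra.lift f) _).trans
        ((congrArg star (h _ _ hxy)).trans (map_star (FreeStarAlgebra.lift f) _).symm)⟩

theorem liftAlg_mk (f : X → A)
    (h : ∀ x y, r x y → FreeStarAlgebra.lift f x = FreeStarAlgebra.lift f y)
    (x : FreeStarAlgebra X) : liftAlg f h (mkAlg r x) = FreeStarAlgebra.lift f x :=
  RingQuot.liftAlgHom_mkAlgHom_apply ℂ _ _ _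

/-- Universal property: elements of a `*`-algebra that satisfy the relations define a
`*`-homomorphism from the presented `*`-algebra. -/
def lift (f : X → A)
    (h : ∀ x y, r x y → FreeStarAlgebra.lift f x = FreeStarAlgebra.lift f y) :
    PresentedStarAlgebra r →⋆ₐ[ℂ] A :=
  { liftAlg f h with
    map_star' := fun x => by
      obtain ⟨x, rfl⟩ := mkAlg_surjective x
      change liftAlg f h (star (mkAlg r x)) = star (liftAlg f h (mkAlg r x))
      rw [← mkAlg_star, liftAlg_mk, liftAlg_mk, map_star] }

@[simp] theorem lift_gen (f : X → A)
    (h : ∀ x y, r x y → FreeStarAlgebra.lift f x = FreeStarAlgebra.lift f y) (x : X) :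
    lift f h (gen r x) = f x :=
  (liftAlg_mk f h _).trans (FreeStarAlgebra.lift_gen f x)

end

end PresentedStarAlgebra

/-! ## The coordinate algebra of `U(1)` -/

/-- The `*`-structure of `𝒪(U(1)) = ℂ[u, u*]`, where `u = T 1`: conjugate-linear with `T n ↦ T (-n)`,
so that `u` is unitary. The Hopf algebra structure of `ℂ[T;T⁻¹]`, with `u` grouplike, is
Mathlib's. -/
noncomputable instance : StarRing ℂ[T;T⁻¹] where
  star f := LaurentPolynomial.invert (AddMonoidAlgebra.mapRingHom ℤ (starRingEnd ℂ) f)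
  star_involutive f := by
    ext n
    simp
  star_mul f g := by
    change LaurentPolynomial.invert (AddMonoidAlgebra.mapRingHom ℤ (starRingEnd ℂ) (f * g)) = _
    rw [map_mul, map_mul, mul_comm]
  star_add f g := by
    change LaurentPolynomial.invert (AddMonoidAlgebra.mapRingHom ℤ (starRingEnd ℂ) (f + g)) = _
    rw [map_add, map_add]

theorem LaurentPolynomial.star_T (n : ℤ) :
    star (LaurentPolynomial.T n : ℂ[T;T⁻¹]) = LaurentPolynomial.T (-n) := by
  change LaurentPolynomial.invert (AddMonoidAlgebra.mapRingHom ℤ (starRingEnd ℂ) _) = _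
  rw [← LaurentPolynomial.invert_T]
  congr 1
  exact (AddMonoidAlgebra.mapRingHom_single _ _ _).trans (by rw [map_one]; rfl)

noncomputable instance : StarModule ℂ ℂ[T;T⁻¹] where
  star_smul c f := by
    change LaurentPolynomial.invert (AddMonoidAlgebra.mapRingHom ℤ (starRingEnd ℂ) _) =
      _ • LaurentPolynomial.invert (AddMonoidAlgebra.mapRingHom ℤ (starRingEnd ℂ) _)
    ext n
    simp

/-! ## The quantum group `SU_q(2)`, i.e. the quantum three-sphere -/

/-- The generators `α`, `β`. -/
inductive SUGen
  | alpha
  | beta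

/-- The defining relations of `𝒪(SU_q(2))`. -/
inductive SURel (q : ℝ) : FreeStarAlgebra SUGen → FreeStarAlgebra SUGen → Prop
  | alpha_beta : SURel q
      (.gen .alpha * .gen .beta)
      ((q : ℂ) • (.gen .beta * .gen .alpha))
  | alpha_star_beta : SURel q
      (.gen .alpha * star (.gen .beta))
      ((q : ℂ) • (star (.gen .beta) * .gen .alpha))
  | beta_normal : SURel q
      (.gen .beta * star (.gen .beta))
      (star (.gen .beta) * .gen .beta)
  | alpha_comm : SURel q
      (.gen .alpha * star (.gen .alpha))
      (star (.gen .alpha) * .gen .alpha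
        + ((q : ℂ) ^ (-2 : ℤ) - 1) • (.gen .beta * star (.gen .beta)))
  | sphere : SURel q
      (.gen .alpha * star (.gen .alpha) + .gen .beta * star (.gen .beta))
      1

/-- `𝒪(SU_q(2)) = 𝒪(S³_q)`. -/
abbrev OSU (q : ℝ) : Type := PresentedStarAlgebra (SURel q)

namespace OSU

noncomputable section

/-- The generator `α`. -/
def α (q : ℝ) : OSU q := PresentedStarAlgebra.gen (SURel q) .alpha

/-- The generator `β`. -/
def β (q : ℝ) : OSU q := PresentedStarAlgebra.gen (SURel q) .beta

theorem α_mul_β (q : ℝ) : α q * β q = (q : ℂ) • (β q * α q) := by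
  unfold α β PresentedStarAlgebra.gen
  simpa only [map_mul, map_smul] using PresentedStarAlgebra.mk_rel (SURel.alpha_beta (q := q))

theorem α_mul_star_β (q : ℝ) : α q * star (β q) = (q : ℂ) • (star (β q) * α q) := by
  unfold α β PresentedStarAlgebra.gen
  simpa only [map_mul, map_smul, map_star] using
    PresentedStarAlgebra.mk_rel (SURel.alpha_star_beta (q := q))

theorem β_mul_star_β (q : ℝ) : β q * star (β q) = star (β q) * β q := by
  unfold β PresentedStarAlgebra.gen
  simpa only [map_mul, map_star] using PresentedStarAlgebra.mk_rel (SURel.beta_normal (q := q))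

theorem α_mul_star_α (q : ℝ) : α q * star (α q) =
    star (α q) * α q + ((q : ℂ) ^ (-2 : ℤ) - 1) • (β q * star (β q)) := by
  unfold α β PresentedStarAlgebra.gen
  simpa only [map_add, map_mul, map_smul, map_star] using
    PresentedStarAlgebra.mk_rel (SURel.alpha_comm (q := q))

theorem α_mul_star_α_add (q : ℝ) : α q * star (α q) + β q * star (β q) = 1 := by
  unfold α β PresentedStarAlgebra.gen
  simpa only [map_add, map_mul, map_star, map_one] using
    PresentedStarAlgebra.mk_rel (SURel.sphere (q := q))

open LaurentPolynomial in
/-- The images `α ⊗ u^k` and `β ⊗ u^{-l}` of the generators under the coaction. -/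
def coactionGen (q : ℝ) (k l : ℕ) : SUGen → OSU q ⊗[ℂ] ℂ[T;T⁻¹]
  | .alpha => α q ⊗ₜ T (k : ℤ)
  | .beta => β q ⊗ₜ T (-(l : ℤ))

/-- The coaction `ϱ_{k,l} : 𝒪(SU_q(2)) → 𝒪(SU_q(2)) ⊗ ℂ[u, u*]`, the `*`-homomorphism with
`α ↦ α ⊗ u^k` and `β ↦ β ⊗ u^{-l}`. -/
def coaction (q : ℝ) (k l : ℕ) : OSU q →⋆ₐ[ℂ] OSU q ⊗[ℂ] ℂ[T;T⁻¹] :=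
  PresentedStarAlgebra.lift (coactionGen q k l) (by
    intro x y h
    cases h <;>
      simp only [map_mul, map_smul, map_star, map_add, map_one, FreeStarAlgebra.lift_gen,
        coactionGen, TensorProduct.star_tmul, LaurentPolynomial.star_T,
        Algebra.TensorProduct.tmul_mul_tmul, ← LaurentPolynomial.T_add, neg_neg,
        TensorProduct.smul_tmul', neg_add_cancel, add_neg_cancel, LaurentPolynomial.T_zero,
        ← TensorProduct.add_tmul]
    · rw [α_mul_β, add_comm]
    · rw [α_mul_star_β, add_comm]
    · rw [β_mul_star_β]
    · rw [α_mul_star_α]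
    · rw [α_mul_star_α_add, Algebra.TensorProduct.one_def])

open LaurentPolynomial in
theorem coaction_α (q : ℝ) (k l : ℕ) : coaction q k l (α q) = α q ⊗ₜ T (k : ℤ) :=
  PresentedStarAlgebra.lift_gen _ _ _

open LaurentPolynomial in
theorem coaction_β (q : ℝ) (k l : ℕ) : coaction q k l (β q) = β q ⊗ₜ T (-(l : ℤ)) :=
  PresentedStarAlgebra.lift_gen _ _ _

end

end OSU

/-! ## The quantum weighted projective lines -/

/-- `𝒪(WP_q(k,l))`: the subalgebra of coinvariants `{x | ϱ_{k,l}(x) = x ⊗ 1}` of `𝒪(SU_q(2))`. -/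
noncomputable def OWP (q : ℝ) (k l : ℕ) : StarSubalgebra ℂ (OSU q) where
  carrier := {x | OSU.coaction q k l x = x ⊗ₜ[ℂ] (1 : ℂ[T;T⁻¹])}
  mul_mem' {x y} hx hy := by
    simp only [Set.mem_ofPred_eq] at hx hy ⊢
    rw [map_mul, hx, hy, Algebra.TensorProduct.tmul_mul_tmul, mul_one]
  add_mem' {x y} hx hy := by
    simp only [Set.mem_ofPred_eq] at hx hy ⊢
    rw [map_add, hx, hy, TensorProduct.add_tmul]
  algebraMap_mem' c := by
    simp only [Set.mem_ofPred_eq]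
    rw [AlgHomClass.commutes, Algebra.TensorProduct.algebraMap_apply]
  star_mem' {x} hx := by
    simp only [Set.mem_ofPred_eq] at hx ⊢
    rw [map_star, hx, TensorProduct.star_tmul, star_one]

/-- The names of the two generators `a`, `b`. -/
inductive WPGen
  | a
  | b

/-- The relations
`a* = a`, `ab = q^{-2l} ba`, `bb* = q^{2kl} a^k ∏_{m=0}^{l-1} (1 - q^{2m} a)`,
`b*b = a^k ∏_{m=1}^{l} (1 - q^{-2m} a)`. The products are over lists, in order of increasing `m`;
the second list runs over `m + 1` for `m = 0, …, l - 1`. -/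
inductive WPRel (q : ℝ) (k l : ℕ) : FreeStarAlgebra WPGen → FreeStarAlgebra WPGen → Prop
  | a_selfAdjoint : WPRel q k l (star (.gen .a)) (.gen .a)
  | a_mul_b : WPRel q k l
      (.gen .a * .gen .b)
      ((q : ℂ) ^ (-2 * (l : ℤ)) • (.gen .b * .gen .a))
  | b_mul_star_b : WPRel q k l
      (.gen .b * star (.gen .b))
      ((q : ℂ) ^ (2 * k * l) • (.gen .a ^ k *
        ((List.range l).map fun m : ℕ => 1 - (q : ℂ) ^ (2 * m) • .gen .a).prod))
  | star_b_mul_b : WPRel q k l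
      (star (.gen .b) * .gen .b)
      (.gen .a ^ k *
        ((List.range l).map fun m : ℕ => 1 - (q : ℂ) ^ (-2 * ((m : ℤ) + 1)) • .gen .a).prod)

/-- The universal `*`-algebra generated by `a`, `b` subject to the relations `WPRel`. -/
abbrev OWPPresented (q : ℝ) (k l : ℕ) : Type := PresentedStarAlgebra (WPRel q k l)

/-! The coaction grades `OSU q` by ℤ, with α in degree k and β in degree -l, and the coinvariants
are the part of degree zero. The homogeneous monomials α^m β^i β*^j and α*^m β^i β*^j span the
algebra (`span_monomials`), so the coefficient of u^0 shows that those of degree zero span the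
coinvariants. Degree zero means mk + jl = il, or the same with i and j exchanged. Coprimality then
forces m = lr and i = kr + j, which makes the monomial a scalar multiple of b^r a^j or (b*)^r a^j.
This gives (i), `OWP_eq_adjoin`, and needs no linear independence. The relations in (ii) hold
because αα* and α*α are affine in a while α and α* commute with a up to a scalar
(`pow_mul_pow_eq_list_prod`).

In (iii), surjectivity is (i). The relations write every element of the universal algebra as a sum
of terms b^s p_s(a) with s in ℤ, where negative powers stand for powers of b*
(`polynomialCombination_surjective`). Injectivity asks that such a sum vanish in `OSU q` only if all
p_s do. This is detected by a representation on functions on ℤ that ignores the involution: α is the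
shift, β acts by q^n and β* by -q^n. Then αα* acts by 1 + q^{2n}, which never vanishes, so the
powers of b and b* are shifts of distinct degrees with nonvanishing weights, and a is diagonal with
infinitely many eigenvalues. Testing on delta functions gives each p_s infinitely many roots
(`eq_zero_of_sum_weightedShift`). -/

/-! ### Normal forms over a normalised subalgebra -/

/-- Products `b ^ n * d` and `c ^ n * d` with coefficients `d ∈ D`. -/
def normalForms {A : Type*} [Ring A] [Algebra ℂ A] (D : Subalgebra ℂ A) (b c : A) : Set A :=
  {x | ∃ n : ℕ, ∃ d ∈ D, x = b ^ n * d ∨ x = c ^ n * d}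

section NormalForms

variable {A : Type*} [Ring A] [Algebra ℂ A] {D : Subalgebra ℂ A} {b c : A}

theorem exists_mul_pow_eq (hb : ∀ d ∈ D, ∃ d' ∈ D, d * b = b * d') (n : ℕ) :
    ∀ d ∈ D, ∃ d' ∈ D, d * b ^ n = b ^ n * d' := by
  induction n with
  | zero => exact fun d hd => ⟨d, hd, by simp⟩
  | succ n ih =>
    intro d hd
    obtain ⟨d₁, hd₁, h₁⟩ := ih d hd
    obtain ⟨d₂, hd₂, h₂⟩ := hb d₁ hd₁
    exact ⟨d₂, hd₂, by rw [pow_succ, ← mul_assoc, h₁, mul_assoc, h₂, mul_assoc]⟩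

theorem mul_mem_normalForms_of_mem (hb : ∀ d ∈ D, ∃ d' ∈ D, d * b = b * d')
    (hc : ∀ d ∈ D, ∃ d' ∈ D, d * c = c * d') {d y : A} (hd : d ∈ D)
    (hy : y ∈ normalForms D b c) : d * y ∈ normalForms D b c := by
  obtain ⟨n, e, he, rfl | rfl⟩ := hy
  · obtain ⟨d', hd', h⟩ := exists_mul_pow_eq hb n d hd
    exact ⟨n, d' * e, D.mul_mem hd' he, Or.inl (by rw [← mul_assoc, h, mul_assoc])⟩
  · obtain ⟨d', hd', h⟩ := exists_mul_pow_eq hc n d hd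
    exact ⟨n, d' * e, D.mul_mem hd' he, Or.inr (by rw [← mul_assoc, h, mul_assoc])⟩

/-- Against a power of `c`, the factor `b` cancels one `c` into `b * c ∈ D`, and this coefficient is
then moved past the remaining power. -/
theorem left_mul_mem_normalForms (hb : ∀ d ∈ D, ∃ d' ∈ D, d * b = b * d')
    (hc : ∀ d ∈ D, ∃ d' ∈ D, d * c = c * d') (hbc : b * c ∈ D) {y : A}
    (hy : y ∈ normalForms D b c) : b * y ∈ normalForms D b c := by
  obtain ⟨n, e, he, rfl | rfl⟩ := hy
  · exact ⟨n + 1, e, he, Or.inl (by rw [pow_succ', mul_assoc])⟩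
  · cases n with
    | zero => exact ⟨1, e, he, Or.inl (by simp)⟩
    | succ n =>
      rw [pow_succ', mul_assoc, ← mul_assoc]
      exact mul_mem_normalForms_of_mem hb hc hbc ⟨n, e, he, Or.inr rfl⟩

theorem normalForms_comm : normalForms D b c = normalForms D c b := by
  ext x
  simp only [normalForms, Set.mem_ofPred_eq, or_comm]

/-- Elements `b`, `c` that normalise `D` and satisfy `b * c, c * b ∈ D` generate over `D` the span
of the normal forms. -/
theorem mem_span_normalForms (hb : ∀ d ∈ D, ∃ d' ∈ D, d * b = b * d')
    (hc : ∀ d ∈ D, ∃ d' ∈ D, d * c = c * d') (hbc : b * c ∈ D) (hcb : c * b ∈ D) {x : A}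
    (hx : x ∈ Algebra.adjoin ℂ ((D : Set A) ∪ {b, c})) :
    x ∈ Submodule.span ℂ (normalForms D b c) := by
  have key : ∀ z, (∀ y ∈ normalForms D b c, z * y ∈ normalForms D b c) →
      ∀ y ∈ Submodule.span ℂ (normalForms D b c), z * y ∈ Submodule.span ℂ (normalForms D b c) := by
    intro z hz y hy
    induction hy using Submodule.span_induction with
    | mem y hy => exact Submodule.subset_span (hz y hy)
    | zero => simp
    | add y₁ y₂ _ _ h₁ h₂ => rw [mul_add]; exact add_mem h₁ h₂
    | smul r y _ h => rw [mul_smul_comm]; exact Submodule.smul_mem _ r h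
  -- The span is not known to be closed under products, so the induction proves that left
  -- multiplication by `x` preserves it; applying this to 1 finishes.
  have main : ∀ y ∈ Submodule.span ℂ (normalForms D b c),
      x * y ∈ Submodule.span ℂ (normalForms D b c) := by
    induction hx using Algebra.adjoin_induction with
    | mem z hz =>
      apply key
      rcases hz with hz | rfl | rfl
      · exact fun y hy => mul_mem_normalForms_of_mem hb hc hz hy
      · exact fun y hy => left_mul_mem_normalForms hb hc hbc hy
      · intro y hy
        rw [normalForms_comm] at hy ⊢
        exact left_mul_mem_normalForms hc hb hcb hy
    | algebraMap r =>
      intro y hy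
      rw [← Algebra.smul_def]
      exact Submodule.smul_mem _ r hy
    | add u v _ _ hu hv => exact fun y hy => by rw [add_mul]; exact add_mem (hu y hy) (hv y hy)
    | mul u v _ _ hu hv => exact fun y hy => by rw [mul_assoc]; exact hu _ (hv y hy)
  have := main 1 (Submodule.subset_span ⟨0, 1, D.one_mem, Or.inl (by simp)⟩)
  rwa [mul_one] at this

/-- An element normalises `adjoin ℂ s` as soon as it rescales the generators. -/
theorem exists_mul_eq_mul_of_adjoin {s : Set A} (hs : ∀ d ∈ s, ∃ r : ℂ, d * b = b * (r • d)) :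
    ∀ d ∈ Algebra.adjoin ℂ s, ∃ d' ∈ Algebra.adjoin ℂ s, d * b = b * d' := by
  intro d hd
  induction hd using Algebra.adjoin_induction with
  | mem d hd =>
    obtain ⟨r, hr⟩ := hs d hd
    exact ⟨r • d, Subalgebra.smul_mem _ (Algebra.subset_adjoin hd) r, hr⟩
  | algebraMap r => exact ⟨algebraMap ℂ A r, Subalgebra.algebraMap_mem _ r, Algebra.commutes r b⟩
  | add u v _ _ hu hv =>
    obtain ⟨u', hu', hu⟩ := hu
    obtain ⟨v', hv', hv⟩ := hv
    exact ⟨u' + v', add_mem hu' hv', by rw [add_mul, mul_add, hu, hv]⟩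
  | mul u v _ _ hu hv =>
    obtain ⟨u', hu', hu⟩ := hu
    obtain ⟨v', hv', hv⟩ := hv
    exact ⟨u' * v', mul_mem hu' hv', by rw [mul_assoc, hv, ← mul_assoc, hu, mul_assoc]⟩

theorem adjoin_pair_le_span_monomials {x y : A} (h : Commute x y) {d : A}
    (hd : d ∈ Algebra.adjoin ℂ {x, y}) :
    d ∈ Submodule.span ℂ {z | ∃ i j : ℕ, z = x ^ i * y ^ j} := by
  rw [← Subalgebra.mem_toSubmodule, Algebra.adjoin_eq_span] at hd
  refine Submodule.span_mono ?_ hd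
  intro z hz
  induction hz using Submonoid.closure_induction with
  | mem z hz =>
    rcases hz with rfl | rfl
    · exact ⟨1, 0, by simp⟩
    · exact ⟨0, 1, by simp⟩
  | one => exact ⟨0, 0, by simp⟩
  | mul u v _ _ hu hv =>
    obtain ⟨i, j, rfl⟩ := hu
    obtain ⟨m, n, rfl⟩ := hv
    refine ⟨i + m, j + n, ?_⟩
    rw [pow_add, pow_add, mul_assoc, ← mul_assoc (y ^ j), ((h.pow_pow m j).eq).symm]
    simp only [mul_assoc]

/-- Commutation up to a scalar passes to powers. -/
theorem pow_mul_pow_eq_smul {x y : A} {r : ℂ} (h : x * y = r • (y * x)) (m n : ℕ) :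
    x ^ m * y ^ n = r ^ (m * n) • (y ^ n * x ^ m) := by
  have h₁ : ∀ n : ℕ, x * y ^ n = r ^ n • (y ^ n * x) := by
    intro n
    induction n with
    | zero => simp
    | succ n ih =>
      rw [pow_succ y, ← mul_assoc, ih, smul_mul_assoc, mul_assoc, h, mul_smul_comm, smul_smul,
        ← pow_succ, mul_assoc]
  induction m with
  | zero => simp
  | succ m ih =>
    rw [pow_succ x, mul_assoc, h₁, mul_smul_comm, ← mul_assoc, ih, smul_mul_assoc, smul_smul,
      mul_assoc, ← pow_add]
    congr 2
    ring

end NormalForms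

section Star

variable {X : Type*} {r : FreeStarAlgebra X → FreeStarAlgebra X → Prop}

/-- With the adjoints counted as generators, a presented `*`-algebra is generated as a plain
algebra, which is the form that the normal-form lemma takes. -/
theorem PresentedStarAlgebra.adjoin_gen_eq_top :
    Algebra.adjoin ℂ {x | ∃ i, x = PresentedStarAlgebra.gen r i ∨
      x = star (PresentedStarAlgebra.gen r i)} = ⊤ := by
  rw [eq_top_iff]
  rintro x -
  obtain ⟨x, rfl⟩ := PresentedStarAlgebra.mk_surjective x
  induction x using FreeStarAlgebra.induction with
  | hc c => rw [AlgHomClass.commutes]; exact Subalgebra.algebraMap_mem _ c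
  | hl s =>
    apply Algebra.subset_adjoin
    cases s with
    | inl i => exact ⟨i, Or.inl rfl⟩
    | inr i => exact ⟨i, Or.inr (by rw [PresentedStarAlgebra.gen, ← map_star,
        FreeStarAlgebra.star_gen])⟩
  | hm x y hx hy => rw [map_mul]; exact mul_mem hx hy
  | ha x y hx hy => rw [map_add]; exact add_mem hx hy

end Star

/-! ### Products of affine factors in one element -/

section ScalarProducts

variable {A : Type*} [Ring A] [Algebra ℂ A]

theorem commute_list_prod_one_sub_smul {x a : A} (h : Commute x a) (f : ℕ → ℂ) (n : ℕ) :
    Commute x ((List.range n).map fun m : ℕ => 1 - f m • a).prod := by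
  refine Commute.list_prod_right _ _ ?_
  intro y hy
  obtain ⟨m, -, rfl⟩ := List.mem_map.mp hy
  exact (Commute.one_right x).sub_right (h.smul_right _)

/-- The innermost `x * y` is affine in `a`, and moving it left past `x ^ n` multiplies the
coefficient of `a` by `r ^ n`. The cases r = q², t = 1 and r = t = q⁻² give α^l α*^l and α*^l α^l.
-/
theorem pow_mul_pow_eq_list_prod {x y a : A} {r t : ℂ} (hxa : x * a = r • (a * x))
    (hxy : x * y = 1 - t • a) (n : ℕ) :
    x ^ n * y ^ n = ((List.range n).map fun m : ℕ => 1 - (t * r ^ m) • a).prod := by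
  induction n with
  | zero => simp
  | succ n ih =>
    have h := pow_mul_pow_eq_smul hxa n 1
    rw [pow_one, mul_one] at h
    have h' : x ^ n * (1 - t • a) = (1 - (t * r ^ n) • a) * x ^ n := by
      rw [mul_sub, sub_mul, mul_one, one_mul, mul_smul_comm, h, smul_smul, smul_mul_assoc]
    rw [pow_succ x, pow_succ' y, mul_assoc, ← mul_assoc x, hxy, ← mul_assoc, h', mul_assoc, ih,
      List.range_succ, List.map_append, List.prod_append, List.map_singleton, List.prod_singleton]
    -- The new factor arises on the left, whereas the list appends it on the right.
    exact (commute_list_prod_one_sub_smul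
      ((Commute.one_left a).sub_left ((Commute.refl a).smul_left _)) _ n)

end ScalarProducts

/-! ### The relations between a and b inside SU_q(2) -/

namespace OSU

variable {q : ℝ}

theorem star_β_mul_star_α : star (β q) * star (α q) = (q : ℂ) • (star (α q) * star (β q)) := by
  simpa [star_smul] using congrArg star (α_mul_β q)

theorem β_mul_star_α : β q * star (α q) = (q : ℂ) • (star (α q) * β q) := by
  simpa [star_smul] using congrArg star (α_mul_star_β q)

theorem β_mul_α (hq : q ≠ 0) : β q * α q = α q * ((q : ℂ)⁻¹ • β q) := by
  have hQ : (q : ℂ) ≠ 0 := Complex.ofReal_ne_zero.mpr hq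
  rw [mul_smul_comm, α_mul_β, smul_smul, inv_mul_cancel₀ hQ, one_smul]

theorem star_β_mul_α (hq : q ≠ 0) : star (β q) * α q = α q * ((q : ℂ)⁻¹ • star (β q)) := by
  have hQ : (q : ℂ) ≠ 0 := Complex.ofReal_ne_zero.mpr hq
  rw [mul_smul_comm, α_mul_star_β, smul_smul, inv_mul_cancel₀ hQ, one_smul]

theorem commute_β_star_β : Commute (β q) (star (β q)) := β_mul_star_β q

theorem α_mul_star_α_eq : α q * star (α q) = 1 - β q * star (β q) :=
  eq_sub_of_add_eq (α_mul_star_α_add q)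

theorem star_α_mul_α_eq :
    star (α q) * α q = 1 - ((q : ℂ) ^ (-2 : ℤ)) • (β q * star (β q)) := by
  have h := α_mul_star_α q
  rw [α_mul_star_α_eq, sub_smul, one_smul] at h
  rw [← sub_eq_iff_eq_add] at h
  rw [← h]
  abel

theorem α_mul_a : α q * (β q * star (β q)) = ((q : ℂ) ^ 2) • (β q * star (β q) * α q) := by
  rw [← mul_assoc, α_mul_β, smul_mul_assoc, mul_assoc, α_mul_star_β, mul_smul_comm, smul_smul,
    mul_assoc, sq]

theorem a_mul_star_α : β q * star (β q) * star (α q) =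
    ((q : ℂ) ^ 2) • (star (α q) * (β q * star (β q))) := by
  simpa [star_smul, mul_assoc] using congrArg star (α_mul_a (q := q))

theorem star_α_mul_a (hq : q ≠ 0) : star (α q) * (β q * star (β q)) =
    ((q : ℂ) ^ (-2 : ℤ)) • (β q * star (β q) * star (α q)) := by
  have hQ : (q : ℂ) ≠ 0 := Complex.ofReal_ne_zero.mpr hq
  rw [a_mul_star_α, smul_smul, zpow_neg, zpow_ofNat, inv_mul_cancel₀ (pow_ne_zero 2 hQ), one_smul]

theorem commute_β_a : Commute (β q) (β q * star (β q)) :=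
  (Commute.refl _).mul_right commute_β_star_β

theorem commute_star_β_a : Commute (star (β q)) (β q * star (β q)) :=
  commute_β_star_β.symm.mul_right (Commute.refl _)

theorem star_a : star (β q * star (β q)) = β q * star (β q) := by
  rw [star_mul, star_star]

theorem a_mul_b (hq : q ≠ 0) (k l : ℕ) :
    β q * star (β q) * (α q ^ l * β q ^ k) =
      (q : ℂ) ^ (-2 * (l : ℤ)) • (α q ^ l * β q ^ k * (β q * star (β q))) := by
  have hQ : (q : ℂ) ≠ 0 := Complex.ofReal_ne_zero.mpr hq
  have h := pow_mul_pow_eq_smul (α_mul_a (q := q)) l 1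
  rw [pow_one, mul_one] at h
  have hc : (q : ℂ) ^ (-2 * (l : ℤ)) * ((q : ℂ) ^ 2) ^ l = 1 := by
    rw [← pow_mul, ← zpow_natCast, ← zpow_add₀ hQ]
    simp
  rw [mul_assoc (α q ^ l) (β q ^ k), (commute_β_a.pow_left k).eq, ← mul_assoc (α q ^ l), h,
    smul_mul_assoc, smul_smul, hc, one_smul, mul_assoc (β q * star (β q)) (α q ^ l)]

/-- The inner β^k β*^k is a^k, and the scalar q^{2kl} is the cost of moving α^l past it. -/
theorem b_mul_star_b (k l : ℕ) :
    α q ^ l * β q ^ k * star (α q ^ l * β q ^ k) =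
      (q : ℂ) ^ (2 * k * l) • ((β q * star (β q)) ^ k *
        ((List.range l).map fun m : ℕ => 1 - (q : ℂ) ^ (2 * m) • (β q * star (β q))).prod) := by
  have h := pow_mul_pow_eq_list_prod α_mul_a
    (show α q * star (α q) = 1 - (1 : ℂ) • (β q * star (β q)) by rw [one_smul, α_mul_star_α_eq]) l
  simp only [one_mul, ← pow_mul] at h
  rw [star_mul, star_pow, star_pow, mul_assoc, ← mul_assoc (β q ^ k), ← commute_β_star_β.mul_pow,
    ← mul_assoc, pow_mul_pow_eq_smul α_mul_a, smul_mul_assoc, mul_assoc, h, ← pow_mul]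
  congr 2
  ring

/-- No scalar appears here: α*^l α^l sits in the middle and is a product of affine factors in a,
which commutes with β. -/
theorem star_b_mul_b (hq : q ≠ 0) (k l : ℕ) :
    star (α q ^ l * β q ^ k) * (α q ^ l * β q ^ k) = (β q * star (β q)) ^ k *
      ((List.range l).map fun m : ℕ =>
        1 - (q : ℂ) ^ (-2 * ((m : ℤ) + 1)) • (β q * star (β q))).prod := by
  have hQ : (q : ℂ) ≠ 0 := Complex.ofReal_ne_zero.mpr hq
  -- The product starts at q⁻² instead of 1 because α*α = 1 - q⁻² a; this is the offset `m + 1`.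
  have hc : ∀ m : ℕ, (q : ℂ) ^ (-2 : ℤ) * ((q : ℂ) ^ (-2 : ℤ)) ^ m =
      (q : ℂ) ^ (-2 * ((m : ℤ) + 1)) := by
    intro m
    rw [← zpow_natCast, ← zpow_mul, ← zpow_add₀ hQ]
    congr 1
    ring
  have h := pow_mul_pow_eq_list_prod (star_α_mul_a hq) star_α_mul_α_eq l
  simp only [hc] at h
  rw [star_mul, star_pow, star_pow, mul_assoc, ← mul_assoc (star (α q) ^ l), h,
    ← ((commute_list_prod_one_sub_smul commute_β_a _ l).pow_left k).eq, ← mul_assoc,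
    ← commute_β_star_β.symm.mul_pow, ← β_mul_star_β]

end OSU

/-! ### Coinvariants -/

namespace OSU

variable {q : ℝ}

theorem mem_span_normalForms (hq : q ≠ 0) (x : OSU q) :
    x ∈ Submodule.span ℂ (normalForms (Algebra.adjoin ℂ {β q, star (β q)}) (α q) (star (α q))) := by
  have ha : β q * star (β q) ∈ Algebra.adjoin ℂ {β q, star (β q)} :=
    mul_mem (Algebra.subset_adjoin (by simp)) (Algebra.subset_adjoin (by simp))
  apply _root_.mem_span_normalForms
  · refine exists_mul_eq_mul_of_adjoin ?_
    rintro d (rfl | rfl)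
    · exact ⟨_, β_mul_α hq⟩
    · exact ⟨_, star_β_mul_α hq⟩
  · refine exists_mul_eq_mul_of_adjoin ?_
    rintro d (rfl | rfl)
    · exact ⟨(q : ℂ), by rw [mul_smul_comm, β_mul_star_α]⟩
    · exact ⟨(q : ℂ), by rw [mul_smul_comm, star_β_mul_star_α]⟩
  · rw [α_mul_star_α_eq]
    exact sub_mem (one_mem _) ha
  · rw [star_α_mul_α_eq]
    exact sub_mem (one_mem _) (Subalgebra.smul_mem _ ha _)
  · have hx : x ∈ (⊤ : Subalgebra ℂ (OSU q)) := trivial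
    rw [← PresentedStarAlgebra.adjoin_gen_eq_top] at hx
    refine Algebra.adjoin_mono ?_ hx
    rintro _ ⟨i | i, rfl | rfl⟩
    · exact Or.inr (Or.inl rfl)
    · exact Or.inr (Or.inr rfl)
    · exact Or.inl (Algebra.subset_adjoin (Or.inl rfl))
    · exact Or.inl (Algebra.subset_adjoin (Or.inr rfl))

/-- The span of the monomials `α^m β^i β*^j` and `α*^m β^i β*^j` is everything. -/
theorem span_monomials (hq : q ≠ 0) (x : OSU q) :
    x ∈ Submodule.span ℂ {x : OSU q | ∃ m i j : ℕ, x = α q ^ m * (β q ^ i * star (β q) ^ j) ∨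
      x = star (α q) ^ m * (β q ^ i * star (β q) ^ j)} := by
  refine Submodule.span_le.mpr ?_ (mem_span_normalForms hq x)
  have key : ∀ (y d : OSU q), d ∈ Algebra.adjoin ℂ {β q, star (β q)} →
      y * d ∈ Submodule.span ℂ {z | ∃ i j : ℕ, z = y * (β q ^ i * star (β q) ^ j)} := by
    intro y d hd
    have := Submodule.mem_map_of_mem (f := LinearMap.mulLeft ℂ y)
      (adjoin_pair_le_span_monomials commute_β_star_β hd)
    rw [Submodule.map_span] at this
    refine Submodule.span_mono ?_ this
    rintro _ ⟨_, ⟨i, j, rfl⟩, rfl⟩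
    exact ⟨i, j, rfl⟩
  rintro _ ⟨m, d, hd, rfl | rfl⟩
  · refine Submodule.span_mono ?_ (key _ d hd)
    rintro _ ⟨i, j, rfl⟩
    exact ⟨m, i, j, Or.inl rfl⟩
  · refine Submodule.span_mono ?_ (key _ d hd)
    rintro _ ⟨i, j, rfl⟩
    exact ⟨m, i, j, Or.inr rfl⟩

end OSU

namespace OSU

variable {q : ℝ}

/-- The projection onto the coinvariants: the coaction followed by the coefficient of `u^0`. -/
noncomputable def coinvariantProj (q : ℝ) (k l : ℕ) : OSU q →ₗ[ℂ] OSU q :=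
  (TensorProduct.rid ℂ (OSU q)).toLinearMap ∘ₗ
    (LinearMap.lTensor (OSU q) (Finsupp.lapply (0 : ℤ) ∘ₗ
      (AddMonoidAlgebra.coeffLinearEquiv ℂ).toLinearMap)) ∘ₗ
    (coaction q k l).toAlgHom.toLinearMap

/-- On homogeneous elements the projection is a choice between identity and zero, so it can be
evaluated on spanning monomials without knowing a basis. -/
theorem coinvariantProj_of_coaction_eq {k l : ℕ} {x : OSU q} {n : ℤ}
    (h : coaction q k l x = x ⊗ₜ[ℂ] LaurentPolynomial.T n) :
    coinvariantProj q k l x = if n = 0 then x else 0 := by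
  have h' : coinvariantProj q k l x = TensorProduct.rid ℂ (OSU q)
      (LinearMap.lTensor (OSU q) (Finsupp.lapply (0 : ℤ) ∘ₗ
      (AddMonoidAlgebra.coeffLinearEquiv ℂ).toLinearMap) (coaction q k l x)) := rfl
  have h2 : (Finsupp.lapply (R := ℂ) (0 : ℤ) ∘ₗ (AddMonoidAlgebra.coeffLinearEquiv ℂ).toLinearMap)
      (LaurentPolynomial.T n : ℂ[T;T⁻¹]) = if n = 0 then (1 : ℂ) else 0 :=
    LaurentPolynomial.T_apply 0 n
  rw [h', h, LinearMap.lTensor_tmul, h2, TensorProduct.rid_tmul]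
  split_ifs <;> simp

theorem coinvariantProj_of_mem {k l : ℕ} {x : OSU q} (h : x ∈ OWP q k l) :
    coinvariantProj q k l x = x := by
  have h' : coaction q k l x = x ⊗ₜ[ℂ] LaurentPolynomial.T 0 := by
    rw [LaurentPolynomial.T_zero]; exact h
  rw [coinvariantProj_of_coaction_eq h', if_pos rfl]

theorem coaction_mul {k l : ℕ} {x y : OSU q} {m n : ℤ}
    (hx : coaction q k l x = x ⊗ₜ[ℂ] LaurentPolynomial.T m)
    (hy : coaction q k l y = y ⊗ₜ[ℂ] LaurentPolynomial.T n) :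
    coaction q k l (x * y) = (x * y) ⊗ₜ[ℂ] LaurentPolynomial.T (m + n) := by
  rw [map_mul, hx, hy, Algebra.TensorProduct.tmul_mul_tmul, LaurentPolynomial.T_add]

theorem coaction_pow {k l : ℕ} {x : OSU q} {m : ℤ}
    (hx : coaction q k l x = x ⊗ₜ[ℂ] LaurentPolynomial.T m) (n : ℕ) :
    coaction q k l (x ^ n) = (x ^ n) ⊗ₜ[ℂ] LaurentPolynomial.T (n * m) := by
  rw [map_pow, hx, Algebra.TensorProduct.tmul_pow, LaurentPolynomial.T_pow]

theorem coaction_star {k l : ℕ} {x : OSU q} {m : ℤ}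
    (hx : coaction q k l x = x ⊗ₜ[ℂ] LaurentPolynomial.T m) :
    coaction q k l (star x) = (star x) ⊗ₜ[ℂ] LaurentPolynomial.T (-m) := by
  rw [map_star, hx, TensorProduct.star_tmul, LaurentPolynomial.star_T]

theorem coaction_monomial (k l m i j : ℕ) :
    coaction q k l (α q ^ m * (β q ^ i * star (β q) ^ j)) =
      (α q ^ m * (β q ^ i * star (β q) ^ j)) ⊗ₜ[ℂ]
        LaurentPolynomial.T (m * k + (i * -(l : ℤ) + j * - -(l : ℤ))) :=
  coaction_mul (coaction_pow (coaction_α q k l) m) (coaction_mul (coaction_pow (coaction_β q k l) i)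
    (coaction_pow (coaction_star (coaction_β q k l)) j))

theorem coaction_star_monomial (k l m i j : ℕ) :
    coaction q k l (star (α q) ^ m * (β q ^ i * star (β q) ^ j)) =
      (star (α q) ^ m * (β q ^ i * star (β q) ^ j)) ⊗ₜ[ℂ]
        LaurentPolynomial.T (m * -(k : ℤ) + (i * -(l : ℤ) + j * - -(l : ℤ))) :=
  coaction_mul (coaction_pow (coaction_star (coaction_α q k l)) m)
    (coaction_mul (coaction_pow (coaction_β q k l) i)
    (coaction_pow (coaction_star (coaction_β q k l)) j))

theorem a_mem_OWP (k l : ℕ) : β q * star (β q) ∈ OWP q k l := by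
  have h := coaction_mul (coaction_β q k l) (coaction_star (coaction_β q k l))
  rw [add_neg_cancel, LaurentPolynomial.T_zero] at h
  exact h

theorem b_mem_OWP (k l : ℕ) : α q ^ l * β q ^ k ∈ OWP q k l := by
  have h := coaction_mul (coaction_pow (coaction_α q k l) l) (coaction_pow (coaction_β q k l) k)
  rw [show ((l : ℤ) * k + k * -(l : ℤ)) = 0 by ring, LaurentPolynomial.T_zero] at h
  exact h

/-- The equation makes `l` divide `m * k`, hence `m` by coprimality; cancelling `l` gives `i`. -/
theorem exists_eq_mul_of_mul_add_eq {k l m i j : ℕ} (hl : 0 < l) (hkl : Nat.Coprime k l)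
    (h : m * k + j * l = i * l) : ∃ r, m = l * r ∧ i = k * r + j := by
  have hd : l ∣ m * k := (Nat.dvd_add_left (Dvd.intro_left j rfl)).mp (h ▸ Dvd.intro_left i rfl)
  obtain ⟨r, rfl⟩ := hkl.symm.dvd_of_dvd_mul_right hd
  refine ⟨r, rfl, Nat.eq_of_mul_eq_mul_right hl ?_⟩
  rw [← h]
  ring

section Adjoin

variable {S : StarSubalgebra ℂ (OSU q)} {k l : ℕ}

/-- Up to a power of q from reordering α and β, this element is b^r. -/
theorem pow_α_mul_pow_β_mem (hq : q ≠ 0) (hb : α q ^ l * β q ^ k ∈ S) (r : ℕ) :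
    α q ^ (l * r) * β q ^ (k * r) ∈ S := by
  have hQ : (q : ℂ) ≠ 0 := Complex.ofReal_ne_zero.mpr hq
  induction r with
  | zero => simp
  | succ r ih =>
    have h : α q ^ (l * (r + 1)) * β q ^ (k * (r + 1)) =
        (q : ℂ) ^ (l * (k * r)) • ((α q ^ (l * r) * β q ^ (k * r)) * (α q ^ l * β q ^ k)) := by
      have h₁ := pow_mul_pow_eq_smul (α_mul_β q) l (k * r)
      rw [mul_add, mul_add, mul_one, mul_one, pow_add, pow_add,
        mul_assoc (α q ^ (l * r)) (α q ^ l), ← mul_assoc (α q ^ l), h₁, smul_mul_assoc,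
        mul_smul_comm]
      simp only [mul_assoc]
    rw [h]
    exact S.smul_mem (mul_mem ih hb) _

theorem monomial_mem (hq : q ≠ 0) (ha : β q * star (β q) ∈ S) (hb : α q ^ l * β q ^ k ∈ S)
    (r j : ℕ) : α q ^ (l * r) * (β q ^ (k * r + j) * star (β q) ^ j) ∈ S := by
  rw [pow_add, mul_assoc (β q ^ (k * r)), ← commute_β_star_β.mul_pow, ← mul_assoc]
  exact mul_mem (pow_α_mul_pow_β_mem hq hb r) (pow_mem ha j)

theorem star_monomial_mem (hq : q ≠ 0) (ha : β q * star (β q) ∈ S) (hb : α q ^ l * β q ^ k ∈ S)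
    (r i : ℕ) : star (α q) ^ (l * r) * (β q ^ i * star (β q) ^ (k * r + i)) ∈ S := by
  have hQ : (q : ℂ) ^ (l * r * (k * r)) ≠ 0 := pow_ne_zero _ (Complex.ofReal_ne_zero.mpr hq)
  have h₁ := star_mem (pow_α_mul_pow_β_mem hq hb r)
  -- Reordering before taking the adjoint puts α* on the left of β*; the resulting nonzero scalar is
  -- divided out afterwards.
  rw [pow_mul_pow_eq_smul (α_mul_β q), star_smul, star_mul, star_pow, star_pow] at h₁
  have h₂ : star (α q) ^ (l * r) * star (β q) ^ (k * r) ∈ S := by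
    have := S.smul_mem h₁ ((q : ℂ) ^ (l * r * (k * r)))⁻¹
    rwa [star_pow, show star (q : ℂ) = q from Complex.conj_ofReal q, smul_smul,
      inv_mul_cancel₀ hQ, one_smul] at this
  rw [add_comm, pow_add, ← mul_assoc (β q ^ i), ← commute_β_star_β.mul_pow,
    ← ((commute_star_β_a.pow_right i).pow_left (k * r)).eq, ← mul_assoc]
  exact mul_mem h₂ (pow_mem ha i)

/-- By linearity only the spanning monomials matter: those of nonzero degree are killed, and those
of degree zero are products of a and b or b* up to a scalar. -/
theorem coinvariantProj_mem (hq : q ≠ 0) (hl : 0 < l) (hkl : Nat.Coprime k l)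
    (ha : β q * star (β q) ∈ S) (hb : α q ^ l * β q ^ k ∈ S) (x : OSU q) :
    coinvariantProj q k l x ∈ S := by
  induction span_monomials hq x using Submodule.span_induction with
  | mem x hx =>
    obtain ⟨m, i, j, rfl | rfl⟩ := hx
    · rw [coinvariantProj_of_coaction_eq (coaction_monomial k l m i j)]
      split_ifs with h
      · obtain ⟨r, rfl, rfl⟩ := exists_eq_mul_of_mul_add_eq (m := m) (i := i) (j := j) hl hkl
          (by zify; linarith)
        exact monomial_mem hq ha hb r j
      · exact S.zero_mem
    · rw [coinvariantProj_of_coaction_eq (coaction_star_monomial k l m i j)]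
      split_ifs with h
      -- α* has degree -k, so the excess now lies in the exponent of β*, and `i` and `j` exchange
      -- roles.
      · obtain ⟨r, rfl, rfl⟩ := exists_eq_mul_of_mul_add_eq (m := m) (i := j) (j := i) hl hkl
          (by zify; linarith)
        exact star_monomial_mem hq ha hb r i
      · exact S.zero_mem
  | zero => rw [map_zero]; exact S.zero_mem
  | add x y _ _ hx hy => rw [map_add]; exact add_mem hx hy
  | smul c x _ hx => rw [map_smul]; exact S.smul_mem hx c

end Adjoin

theorem OWP_eq_adjoin (hq : q ≠ 0) {k l : ℕ} (hl : 0 < l) (hkl : Nat.Coprime k l) :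
    OWP q k l = StarAlgebra.adjoin ℂ {β q * star (β q), α q ^ l * β q ^ k} := by
  apply le_antisymm
  · intro x hx
    rw [← coinvariantProj_of_mem hx]
    exact coinvariantProj_mem hq hl hkl (StarAlgebra.subset_adjoin ℂ _ (by simp))
      (StarAlgebra.subset_adjoin ℂ _ (by simp)) x
  · refine StarAlgebra.adjoin_le ?_
    rintro x (rfl | rfl)
    · exact a_mem_OWP k l
    · exact b_mem_OWP k l

end OSU

/-! ### Weighted shifts on `ℤ → ℂ` -/

/-- `T` is a shift by `d` with nowhere vanishing weight. -/
def IsWeightedShift (d : ℤ) (T : Module.End ℂ (ℤ → ℂ)) : Prop :=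
  ∃ w : ℤ → ℂ, (∀ n, w n ≠ 0) ∧ ∀ f n, T f n = w n * f (n + d)

/-- The shift by `d` with weight `w`. -/
def weightedShift (d : ℤ) (w : ℤ → ℂ) : Module.End ℂ (ℤ → ℂ) where
  toFun f n := w n * f (n + d)
  map_add' f g := by ext n; simp [mul_add]
  map_smul' c f := by ext n; simp [mul_left_comm]

@[simp] theorem weightedShift_apply (d : ℤ) (w f : ℤ → ℂ) (n : ℤ) :
    weightedShift d w f n = w n * f (n + d) := rfl

theorem isWeightedShift_weightedShift (d : ℤ) {w : ℤ → ℂ} (hw : ∀ n, w n ≠ 0) :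
    IsWeightedShift d (weightedShift d w) := ⟨w, hw, fun _ _ => rfl⟩

theorem IsWeightedShift.one : IsWeightedShift 0 1 :=
  ⟨fun _ => 1, fun _ => one_ne_zero, fun f n => by simp⟩

theorem IsWeightedShift.mul {d e : ℤ} {T U : Module.End ℂ (ℤ → ℂ)} (hT : IsWeightedShift d T)
    (hU : IsWeightedShift e U) : IsWeightedShift (d + e) (T * U) := by
  obtain ⟨v, hv, hT⟩ := hT
  obtain ⟨w, hw, hU⟩ := hU
  refine ⟨fun n => v n * w (n + d), fun n => mul_ne_zero (hv n) (hw _), fun f n => ?_⟩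
  rw [Module.End.mul_apply, hT, hU, mul_assoc, add_assoc]

theorem IsWeightedShift.pow {d : ℤ} {T : Module.End ℂ (ℤ → ℂ)} (hT : IsWeightedShift d T) (n : ℕ) :
    IsWeightedShift (n * d) (T ^ n) := by
  induction n with
  | zero => simpa using IsWeightedShift.one
  | succ n ih =>
    rw [pow_succ]
    convert ih.mul hT using 1
    push_cast
    ring

/-- Polynomials in a diagonal operator act diagonally. -/
theorem aeval_diagonal_apply {T : Module.End ℂ (ℤ → ℂ)} {w : ℤ → ℂ}
    (hT : ∀ f n, T f n = w n * f n) (p : Polynomial ℂ) (f : ℤ → ℂ) (n : ℤ) :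
    Polynomial.aeval T p f n = p.eval (w n) * f n := by
  -- The function varies because the monomial step uses the induction hypothesis at `T f`.
  induction p using Polynomial.induction_on generalizing f with
  | C c => simp [Module.algebraMap_end_apply]
  | add p r hp hr => simp [hp, hr, add_mul]
  | monomial m c ih =>
    rw [pow_succ, ← mul_assoc, map_mul, Module.End.mul_apply, ih, Polynomial.aeval_X, hT]
    simp [mul_assoc]

/-- Weighted shifts of pairwise distinct degrees are linearly independent over the polynomials in a
diagonal operator with infinitely many eigenvalues. -/
theorem eq_zero_of_sum_weightedShift {T : Module.End ℂ (ℤ → ℂ)} {w : ℤ → ℂ}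
    (hw : Function.Injective w) (hT : ∀ f n, T f n = w n * f n) {e : ℤ → Module.End ℂ (ℤ → ℂ)}
    {l : ℤ} (hl : l ≠ 0) (he : ∀ s, IsWeightedShift (s * l) (e s)) (p : ℤ →₀ Polynomial ℂ)
    (hp : p.sum (fun s r => e s * Polynomial.aeval T r) = 0) : p = 0 := by
  ext1 s
  have hz : ∀ n, (p s).eval (w n) = 0 := by
    intro n
    -- The delta function at `n`, evaluated at `n - s * l`, is seen only by the shift of degree `s *
    -- l`; as `l ≠ 0`, this isolates the index `s`.
    have h := congrFun (LinearMap.congr_fun hp (Pi.single n 1)) (n - s * l)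
    have hterm : ∀ t, t ≠ s →
        (e t * Polynomial.aeval T (p t)) (Pi.single n 1) (n - s * l) = 0 := by
      intro t ht
      obtain ⟨v, -, hv⟩ := he t
      rw [Module.End.mul_apply, hv, aeval_diagonal_apply hT, Pi.single_eq_of_ne, mul_zero, mul_zero]
      intro h
      apply ht
      apply mul_right_cancel₀ hl
      linarith
    rw [Finsupp.sum, LinearMap.sum_apply, Finset.sum_apply, Finset.sum_eq_single s
      (fun t _ ht => hterm t ht) (fun hs => by simp [Finsupp.notMem_support_iff.mp hs])] at h
    obtain ⟨v, hv0, hv⟩ := he s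
    rw [Module.End.mul_apply, hv, aeval_diagonal_apply hT, sub_add_cancel, Pi.single_eq_same,
      mul_one] at h
    exact (mul_eq_zero.mp h).resolve_left (hv0 _)
  rw [Finsupp.coe_zero, Pi.zero_apply]
  exact Polynomial.eq_zero_of_infinite_isRoot _
    ((Set.infinite_range_of_injective hw).mono (by rintro _ ⟨n, rfl⟩; exact hz n))

/-! ### A representation of `𝒪(SU_q(2))` by weighted shifts -/

namespace OSU

variable {q : ℝ}

/-- The operators that represent `α`, `β`, `α*`, `β*`. -/
noncomputable def shiftGen (q : ℝ) : SUGen ⊕ SUGen → Module.End ℂ (ℤ → ℂ)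
  | .inl .alpha => weightedShift 1 1
  | .inl .beta => weightedShift 0 fun n => (q : ℂ) ^ n
  | .inr .alpha => weightedShift (-1) fun n => 1 + (q : ℂ) ^ (2 * (n - 1))
  | .inr .beta => weightedShift 0 fun n => -(q : ℂ) ^ n

/-- The algebra map on the free `*`-algebra given by `shiftGen`. -/
noncomputable def shiftHom (q : ℝ) : FreeStarAlgebra SUGen →ₐ[ℂ] Module.End ℂ (ℤ → ℂ) :=
  FreeAlgebra.lift ℂ (shiftGen q)

theorem shiftHom_letter (q : ℝ) (s : SUGen ⊕ SUGen) :
    shiftHom q (FreeStarAlgebra.letter s) = shiftGen q s :=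
  FreeAlgebra.lift_ι_apply _ _

/-- The representation does not respect the involution, so the adjoint relations do not follow from
the original ones and are checked too. -/
theorem shiftHom_rel (hq : q ≠ 0) {x y : FreeStarAlgebra SUGen} (h : StarClosure (SURel q) x y) :
    shiftHom q x = shiftHom q y := by
  have hQ : (q : ℂ) ≠ 0 := Complex.ofReal_ne_zero.mpr hq
  have hs : (starRingEnd ℂ) (q : ℂ) = q := Complex.conj_ofReal q
  rcases h with h | h <;> cases h <;>
    simp only [star_mul, star_add, star_sub, star_smul, star_one,
      FreeStarAlgebra.star_letter, Sum.swap_inr, Sum.swap_inl,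
      FreeStarAlgebra.gen, map_mul, map_add, map_smul, map_one, shiftHom_letter,
      shiftGen, star_zpow₀, RCLike.star_def, hs] <;>
    refine LinearMap.ext fun f => funext fun n => ?_ <;>
    simp only [Module.End.mul_apply, LinearMap.add_apply, LinearMap.smul_apply, Pi.add_apply,
      Pi.smul_apply, weightedShift_apply, smul_eq_mul, Module.End.one_apply, Pi.one_apply,
      zpow_add₀ hQ, zpow_sub₀ hQ, mul_sub, two_mul, add_zero,
      neg_add_cancel_right, add_neg_cancel_right, zpow_neg, zpow_ofNat] <;>
    field_simp <;> ring

/-- The (non-involutive) representation of `𝒪(SU_q(2))` on `ℤ → ℂ` by weighted shifts in which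
`ββ*` has the eigenvalues `-q^{2n}`, so that no weight vanishes. -/
noncomputable def shiftRep (hq : q ≠ 0) : OSU q →ₐ[ℂ] Module.End ℂ (ℤ → ℂ) :=
  RingQuot.liftAlgHom ℂ ⟨shiftHom q, fun _ _ h => shiftHom_rel hq h⟩

theorem shiftRep_mk (hq : q ≠ 0) (x : FreeStarAlgebra SUGen) :
    shiftRep hq (PresentedStarAlgebra.mk (SURel q) x) = shiftHom q x :=
  RingQuot.liftAlgHom_mkAlgHom_apply ℂ _ _ _

end OSU

/-! ### Expansions in powers of b and b* with polynomial coefficients in a -/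

/-- The powers of `b` for `n ≥ 0`, and of `b*` for `n < 0`. -/
def starZPow {A : Type*} [Monoid A] [Star A] (b : A) : ℤ → A
  | .ofNat n => b ^ n
  | .negSucc n => star b ^ (n + 1)

section PolynomialCombination

variable {A B : Type*} [Ring A] [Algebra ℂ A] [Ring B] [Algebra ℂ B]

/-- The combination `∑ s, e s * (p s)(a)` of the elements `e s` with polynomials in `a`. -/
noncomputable def polynomialCombination (e : ℤ → A) (a : A) : (ℤ →₀ Polynomial ℂ) →ₗ[ℂ] A :=
  Finsupp.lsum ℂ fun s => LinearMap.mulLeft ℂ (e s) ∘ₗ (Polynomial.aeval a).toLinearMap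

theorem polynomialCombination_apply (e : ℤ → A) (a : A) (p : ℤ →₀ Polynomial ℂ) :
    polynomialCombination e a p = p.sum fun s r => e s * Polynomial.aeval a r := rfl

theorem map_polynomialCombination (f : A →ₐ[ℂ] B) (e : ℤ → A) (a : A) (p : ℤ →₀ Polynomial ℂ) :
    f (polynomialCombination e a p) =
      p.sum fun s r => f (e s) * Polynomial.aeval (f a) r := by
  simp [polynomialCombination_apply, Finsupp.sum, Polynomial.aeval_algHom_apply]

end PolynomialCombination

theorem list_prod_one_sub_smul_mem {A : Type*} [Ring A] [Algebra ℂ A] (a : A) (f : ℕ → ℂ) (n : ℕ) :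
    ((List.range n).map fun m : ℕ => 1 - f m • a).prod ∈ Algebra.adjoin ℂ {a} := by
  refine list_prod_mem ?_
  intro y hy
  obtain ⟨m, -, rfl⟩ := List.mem_map.mp hy
  exact sub_mem (one_mem _) (Subalgebra.smul_mem _ (Algebra.self_mem_adjoin_singleton ℂ a) _)

/-! ### The universal algebra and its map onto the coinvariants -/

namespace OWPPresented

variable {q : ℝ} {k l : ℕ}

/-- The generator `a` of the universal `*`-algebra. -/
noncomputable def genA (q : ℝ) (k l : ℕ) : OWPPresented q k l :=
  PresentedStarAlgebra.gen (WPRel q k l) .a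

/-- The generator `b` of the universal `*`-algebra. -/
noncomputable def genB (q : ℝ) (k l : ℕ) : OWPPresented q k l :=
  PresentedStarAlgebra.gen (WPRel q k l) .b

theorem star_genA : star (genA q k l) = genA q k l := by
  unfold genA PresentedStarAlgebra.gen
  simpa only [map_star] using PresentedStarAlgebra.mk_rel (WPRel.a_selfAdjoint (q := q))

theorem genA_mul_genB : genA q k l * genB q k l =
    (q : ℂ) ^ (-2 * (l : ℤ)) • (genB q k l * genA q k l) := by
  unfold genA genB PresentedStarAlgebra.gen
  simpa only [map_mul, map_smul] using
    PresentedStarAlgebra.mk_rel (WPRel.a_mul_b (q := q) (k := k) (l := l))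

theorem genA_mul_star_genB (hq : q ≠ 0) : genA q k l * star (genB q k l) =
    star (genB q k l) * (((q : ℂ) ^ (-2 * (l : ℤ)))⁻¹ • genA q k l) := by
  have hQ : (q : ℂ) ^ (-2 * (l : ℤ)) ≠ 0 := zpow_ne_zero _ (Complex.ofReal_ne_zero.mpr hq)
  have hs : (starRingEnd ℂ) (q : ℂ) = q := Complex.conj_ofReal q
  have h := congrArg star (genA_mul_genB (q := q) (k := k) (l := l))
  rw [star_mul, star_smul, star_mul, star_genA, star_zpow₀, RCLike.star_def, hs] at h
  rw [mul_smul_comm, h, smul_smul, inv_mul_cancel₀ hQ, one_smul]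

theorem genB_mul_star_genB_mem :
    genB q k l * star (genB q k l) ∈ Algebra.adjoin ℂ {genA q k l} := by
  have h : genB q k l * star (genB q k l) = (q : ℂ) ^ (2 * k * l) • (genA q k l ^ k *
        ((List.range l).map fun m : ℕ => 1 - (q : ℂ) ^ (2 * m) • genA q k l).prod) := by
    unfold genA genB PresentedStarAlgebra.gen
    simpa only [map_mul, map_smul, map_star, map_pow, map_list_prod, List.map_map,
      Function.comp_def, map_sub, map_one] using
      PresentedStarAlgebra.mk_rel (WPRel.b_mul_star_b (q := q) (k := k) (l := l))
  rw [h]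
  exact Subalgebra.smul_mem _ (mul_mem (pow_mem (Algebra.self_mem_adjoin_singleton ℂ _) k)
    (list_prod_one_sub_smul_mem _ _ _)) _

theorem star_genB_mul_genB_mem :
    star (genB q k l) * genB q k l ∈ Algebra.adjoin ℂ {genA q k l} := by
  have h : star (genB q k l) * genB q k l = genA q k l ^ k *
        ((List.range l).map fun m : ℕ =>
          1 - (q : ℂ) ^ (-2 * ((m : ℤ) + 1)) • genA q k l).prod := by
    unfold genA genB PresentedStarAlgebra.gen
    simpa only [map_mul, map_smul, map_star, map_pow, map_list_prod, List.map_map,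
      Function.comp_def, map_sub, map_one] using
      PresentedStarAlgebra.mk_rel (WPRel.star_b_mul_b (q := q) (k := k) (l := l))
  rw [h]
  exact mul_mem (pow_mem (Algebra.self_mem_adjoin_singleton ℂ _) k) (list_prod_one_sub_smul_mem _ _ _)

/-- Both b and b* rescale a, and bb* and b*b are polynomials in a, so the normal-form lemma applies
with coefficients in ℂ[a]. -/
theorem polynomialCombination_surjective (hq : q ≠ 0) :
    Function.Surjective (polynomialCombination (starZPow (genB q k l)) (genA q k l)) := by
  intro x
  have hx : x ∈ Submodule.span ℂ (normalForms (Algebra.adjoin ℂ {genA q k l}) (genB q k l)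
      (star (genB q k l))) := by
    apply mem_span_normalForms _ _ genB_mul_star_genB_mem star_genB_mul_genB_mem
    · have hx : x ∈ (⊤ : Subalgebra ℂ (OWPPresented q k l)) := trivial
      rw [← PresentedStarAlgebra.adjoin_gen_eq_top] at hx
      refine Algebra.adjoin_mono ?_ hx
      rintro _ ⟨i | i, rfl | rfl⟩
      · exact Or.inl (Algebra.self_mem_adjoin_singleton ℂ _)
      · refine Or.inl ?_
        change star (genA q k l) ∈ _
        rw [star_genA]
        exact Algebra.self_mem_adjoin_singleton ℂ _
      · exact Or.inr (Or.inl rfl)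
      · exact Or.inr (Or.inr rfl)
    · refine exists_mul_eq_mul_of_adjoin ?_
      rintro d rfl
      exact ⟨_, by rw [genA_mul_genB, mul_smul_comm]⟩
    · refine exists_mul_eq_mul_of_adjoin ?_
      rintro d rfl
      exact ⟨_, genA_mul_star_genB hq⟩
  rw [← LinearMap.mem_range]
  refine Submodule.span_le.mpr ?_ hx
  rintro _ ⟨n, d, hd, h⟩
  rw [Algebra.adjoin_singleton_eq_range_aeval] at hd
  obtain ⟨p, rfl⟩ := hd
  have hs : ∀ s : ℤ, starZPow (genB q k l) s * Polynomial.aeval (genA q k l) p ∈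
      LinearMap.range (polynomialCombination (starZPow (genB q k l)) (genA q k l)) := fun s =>
    ⟨Finsupp.single s p, by rw [polynomialCombination_apply, Finsupp.sum_single_index (by simp)]⟩
  rcases h with rfl | rfl
  · exact hs (Int.ofNat n)
  -- The index -1 already means b*, so the zeroth power of b* is filed under index 0.
  · cases n with
    | zero => simpa [starZPow] using hs (Int.ofNat 0)
    | succ n => exact hs (Int.negSucc n)

/-- The `*`-homomorphism from the universal `*`-algebra to the coinvariants. -/
noncomputable def toOWP (hq : q ≠ 0) (k l : ℕ) : OWPPresented q k l →⋆ₐ[ℂ] OWP q k l :=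
  PresentedStarAlgebra.lift
    (fun
      | .a => ⟨OSU.β q * star (OSU.β q), OSU.a_mem_OWP k l⟩
      | .b => ⟨OSU.α q ^ l * OSU.β q ^ k, OSU.b_mem_OWP k l⟩) (by
    intro x y h
    apply Subtype.val_injective
    change (OWP q k l).subtype _ = (OWP q k l).subtype _
    cases h <;>
      simp only [map_mul, map_smul, map_star, map_pow, map_list_prod, List.map_map,
        Function.comp_def, map_sub, map_one, FreeStarAlgebra.lift_gen,
        StarSubalgebra.subtype_apply]
    · exact OSU.star_a
    · exact OSU.a_mul_b hq k l
    · exact OSU.b_mul_star_b k l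
    · exact OSU.star_b_mul_b hq k l)

theorem coe_toOWP_genA (hq : q ≠ 0) :
    (toOWP hq k l (genA q k l) : OSU q) = OSU.β q * star (OSU.β q) :=
  congrArg Subtype.val (PresentedStarAlgebra.lift_gen _ _ WPGen.a)

theorem coe_toOWP_genB (hq : q ≠ 0) :
    (toOWP hq k l (genB q k l) : OSU q) = OSU.α q ^ l * OSU.β q ^ k :=
  congrArg Subtype.val (PresentedStarAlgebra.lift_gen _ _ WPGen.b)

theorem toOWP_surjective (hq : q ≠ 0) (hl : 0 < l) (hkl : Nat.Coprime k l) :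
    Function.Surjective (toOWP hq k l) := by
  rintro ⟨x, hx⟩
  have hle : OWP q k l ≤ (((OWP q k l).subtype).comp (toOWP hq k l)).range := by
    refine (OSU.OWP_eq_adjoin hq hl hkl).le.trans (StarAlgebra.adjoin_le ?_)
    rintro _ (rfl | rfl)
    · exact ⟨genA q k l, coe_toOWP_genA hq⟩
    · exact ⟨genB q k l, coe_toOWP_genB hq⟩
  obtain ⟨y, hy⟩ := hle hx
  exact ⟨y, Subtype.ext hy⟩

end OWPPresented

/-! ### The images of a, b and b* as weighted shifts -/

namespace OSU

variable {q : ℝ}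

theorem shiftRep_α (hq : q ≠ 0) : shiftRep hq (α q) = shiftGen q (.inl .alpha) :=
  (shiftRep_mk hq _).trans (shiftHom_letter q _)

theorem shiftRep_β (hq : q ≠ 0) : shiftRep hq (β q) = shiftGen q (.inl .beta) :=
  (shiftRep_mk hq _).trans (shiftHom_letter q _)

theorem shiftRep_star_α (hq : q ≠ 0) : shiftRep hq (star (α q)) = shiftGen q (.inr .alpha) := by
  rw [α, PresentedStarAlgebra.gen, ← map_star, FreeStarAlgebra.star_gen, shiftRep_mk,
    shiftHom_letter]

theorem shiftRep_star_β (hq : q ≠ 0) : shiftRep hq (star (β q)) = shiftGen q (.inr .beta) := by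
  rw [β, PresentedStarAlgebra.gen, ← map_star, FreeStarAlgebra.star_gen, shiftRep_mk,
    shiftHom_letter]

theorem isWeightedShift_shiftRep_b (hq : q ≠ 0) (k l : ℕ) :
    IsWeightedShift l (shiftRep hq (α q ^ l * β q ^ k)) := by
  have hQ : (q : ℂ) ≠ 0 := Complex.ofReal_ne_zero.mpr hq
  rw [map_mul, map_pow, map_pow, shiftRep_α, shiftRep_β]
  have h₁ : IsWeightedShift 1 (shiftGen q (.inl .alpha)) :=
    isWeightedShift_weightedShift 1 fun _ => one_ne_zero
  have h₂ : IsWeightedShift 0 (shiftGen q (.inl .beta)) :=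
    isWeightedShift_weightedShift 0 fun n => zpow_ne_zero n hQ
  simpa using (h₁.pow l).mul (h₂.pow k)

theorem isWeightedShift_shiftRep_star_b (hq : q ≠ 0) (k l : ℕ) :
    IsWeightedShift (-l) (shiftRep hq (star (α q ^ l * β q ^ k))) := by
  have hQ : (q : ℂ) ≠ 0 := Complex.ofReal_ne_zero.mpr hq
  rw [star_mul, star_pow, star_pow, map_mul, map_pow, map_pow, shiftRep_star_α, shiftRep_star_β]
  have h₁ : IsWeightedShift (-1) (shiftGen q (.inr .alpha)) := by
    refine isWeightedShift_weightedShift (-1) fun n => ?_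
    -- The exponent is even, so the power is positive whatever the sign of q.
    have hn : (0 : ℝ) < q ^ (2 * (n - 1)) := by
      rw [zpow_mul]
      exact zpow_pos (by positivity) _
    have : (1 + q ^ (2 * (n - 1)) : ℝ) ≠ 0 := by positivity
    exact_mod_cast this
  have h₂ : IsWeightedShift 0 (shiftGen q (.inr .beta)) :=
    isWeightedShift_weightedShift 0 fun n => neg_ne_zero.mpr (zpow_ne_zero n hQ)
  simpa using (h₂.pow k).mul (h₁.pow l)

theorem shiftRep_a_apply (hq : q ≠ 0) (f : ℤ → ℂ) (n : ℤ) :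
    shiftRep hq (β q * star (β q)) f n = -((q : ℂ) ^ n * (q : ℂ) ^ n) * f n := by
  rw [map_mul, shiftRep_β, shiftRep_star_β, Module.End.mul_apply]
  simp only [shiftGen, weightedShift_apply, add_zero]
  ring

theorem isWeightedShift_shiftRep_starZPow (hq : q ≠ 0) (k l : ℕ) (s : ℤ) :
    IsWeightedShift (s * l) (shiftRep hq (starZPow (α q ^ l * β q ^ k) s)) := by
  cases s with
  | ofNat n =>
    have := (isWeightedShift_shiftRep_b hq k l).pow n
    rwa [← map_pow] at this
  | negSucc n =>
    have := (isWeightedShift_shiftRep_star_b hq k l).pow (n + 1)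
    rw [← map_pow] at this
    rwa [show ((n + 1 : ℕ) : ℤ) * -(l : ℤ) = Int.negSucc n * l by
      rw [Int.negSucc_eq]; push_cast; ring] at this

end OSU

/-! ### Injectivity and the main theorem -/

namespace OWPPresented

variable {q : ℝ} {k l : ℕ}

/-- Composed with the shift representation, an expansion in the kernel becomes a vanishing sum of
shifts of distinct degrees over polynomials in a diagonal operator, so its coefficients are zero. -/
theorem toOWP_injective (hq0 : 0 < q) (hq1 : q < 1) (hl : 0 < l) :
    Function.Injective (toOWP hq0.ne' k l) := by
  have hq := hq0.ne'
  let F : OWPPresented q k l →ₐ[ℂ] Module.End ℂ (ℤ → ℂ) := (OSU.shiftRep hq).comp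
    (((OWP q k l).subtype.comp (toOWP hq k l)) : OWPPresented q k l →⋆ₐ[ℂ] OSU q).toAlgHom
  have hF : ∀ x, F x = OSU.shiftRep hq (toOWP hq k l x) := fun _ => rfl
  -- The eigenvalues -q^{2n} of a are pairwise distinct since 0 < q < 1.
  have hw : Function.Injective fun n : ℤ => -((q : ℂ) ^ n * (q : ℂ) ^ n) := by
    intro m n h
    have h' : (q ^ 2) ^ m = (q ^ 2) ^ n := by
      have : -(q ^ m * q ^ m) = -(q ^ n * q ^ n) := by
        simpa only [← Complex.ofReal_zpow, ← Complex.ofReal_mul, ← Complex.ofReal_neg,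
          Complex.ofReal_inj] using h
      rw [sq, mul_zpow, mul_zpow]
      exact neg_inj.mp this
    exact zpow_right_injective₀ (by positivity) (by nlinarith) h'
  have hb : ∀ s, (toOWP hq k l (starZPow (genB q k l) s) : OSU q) =
      starZPow (OSU.α q ^ l * OSU.β q ^ k) s := by
    intro s
    have hB := coe_toOWP_genB (k := k) (l := l) hq
    cases s with
    | ofNat n => simp only [starZPow, map_pow, SubmonoidClass.coe_pow, hB]
    | negSucc n =>
      simp only [starZPow, map_pow, map_star, SubmonoidClass.coe_pow, StarMemClass.coe_star, hB]
  rw [injective_iff_map_eq_zero]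
  intro x hx
  obtain ⟨p, rfl⟩ := polynomialCombination_surjective hq x
  have h := hF (polynomialCombination (starZPow (genB q k l)) (genA q k l) p)
  rw [hx, ZeroMemClass.coe_zero, map_zero, map_polynomialCombination] at h
  have hp := eq_zero_of_sum_weightedShift hw
    (fun f n => by rw [hF, coe_toOWP_genA]; exact OSU.shiftRep_a_apply hq f n)
    (Int.natCast_ne_zero.mpr hl.ne')
    (fun s => by
      rw [hF, hb]
      exact OSU.isWeightedShift_shiftRep_starZPow hq k l s) p h
  rw [hp, map_zero]

end OWPPresented

theorem theorem2p1 (q : ℝ) (hq0 : 0 < q) (hq1 : q < 1) (k l : ℕ) (hk : 0 < k) (hl : 0 < l)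
    (hkl : Nat.Coprime k l) (a b : OSU q)
    (ha : a = OSU.β q * star (OSU.β q)) (hb : b = OSU.α q ^ l * OSU.β q ^ k) :
    -- the coinvariants are the `*`-subalgebra generated by `a` and `b`
    OWP q k l = StarAlgebra.adjoin ℂ {a, b} ∧
    -- the generators satisfy the relations
    (star a = a ∧
      a * b = (q : ℂ) ^ (-2 * (l : ℤ)) • (b * a) ∧
      b * star b = (q : ℂ) ^ (2 * k * l) • (a ^ k *
        ((List.range l).map fun m : ℕ => 1 - (q : ℂ) ^ (2 * m) • a).prod) ∧
      star b * b = a ^ k *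
        ((List.range l).map fun m : ℕ => 1 - (q : ℂ) ^ (-2 * ((m : ℤ) + 1)) • a).prod) ∧
    -- the universal `*`-algebra on these relations is isomorphic to the coinvariants
    ∃ θ : OWPPresented q k l ≃⋆ₐ[ℂ] OWP q k l,
      (θ (PresentedStarAlgebra.gen (WPRel q k l) .a) : OSU q) = a ∧
      (θ (PresentedStarAlgebra.gen (WPRel q k l) .b) : OSU q) = b := by
  subst ha hb
  have hq := hq0.ne'
  exact ⟨OSU.OWP_eq_adjoin hq hl hkl,
    ⟨OSU.star_a, OSU.a_mul_b hq k l, OSU.b_mul_star_b k l, OSU.star_b_mul_b hq k l⟩,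
    StarAlgEquiv.ofBijective (OWPPresented.toOWP hq k l)
      ⟨OWPPresented.toOWP_injective hq0 hq1 hl, OWPPresented.toOWP_surjective hq hl hkl⟩,
    OWPPresented.coe_toOWP_genA hq, OWPPresented.coe_toOWP_genB hq⟩
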